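/- An (affine) special Kähler structure on a Riemann surface $\Sigma_0$ with complex structure $I$ is a pair $(g,\nabla)$, where $g$ is a smooth Kähler metric on $\Sigma_0$ with Kähler form $\omega(\cdot,\cdot)=g(I\cdot,\cdot)$ and $\nabla$ is a smooth flat torsion-free connection on $T\Sigma_0$ such that $\nabla\omega=0$ and $(\nabla_X I)Y=(\nabla_Y I)X$ for all vector fields $X,Y$. Its associated cubic form is the holomorphic cubic differential $\Xi(X,Y,Z)=-\omega(\pi X,(\nabla_Y\pi)Z)$, where $\pi=\tfrac12(1-\sqrt{-1}\,I)\colon T\Sigma_0\otimes\mathbb C\to T^{1,0}\Sigma_0$ is the projection and $\omega$ is extended complex bilinearly. Let $S\subset\mathbb P^1$ be a finite set and let $(g,\nabla)$ be a special Kähler structure on $\mathbb P^1\setminus S$ whose associated cubic form $\Xi$ does not vanish identically and is meromorphic on $\mathbb P^1$, i.e. each point of $S$ is at worst a pole of $\Xi$. Then $(g,\nabla)$ has at least three singular points, i.e. there are at least three points $p\in S$ such that $(g,\nabla)$ does not extend to a (smooth) special Kähler structure on $(\mathbb P^1\setminus S)\cup\{p\}$. In particular $S$ has at least three elements. -/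

import Mathlib

open scoped Manifold ContDiff Topology

/-! ### The Riemann sphere -/

/-- The complex projective line `ℙ¹ = ℂ ∪ {∞}`. -/
abbrev P1 : Type := OnePoint ℂ

namespace P1

open OnePoint

/-- The coordinate `z` on `ℙ¹ ∖ {∞}`. -/
noncomputable def affineChart : OpenPartialHomeomorph P1 ℂ where
  toFun x := x.elim 0 id
  invFun z := (z : P1)
  source := {infty}ᶜ
  target := Set.univ
  map_source' _ _ := Set.mem_univ _
  map_target' z _ := coe_ne_infty z
  left_inv' x hx := by
    induction x using OnePoint.rec with
    | infty => exact absurd rfl hx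
    | coe z => rfl
  right_inv' _ _ := rfl
  open_source := isClosed_infty.isOpen_compl
  open_target := isOpen_univ
  continuousOn_toFun x hx := by
    induction x using OnePoint.rec with
    | infty => exact absurd rfl hx
    | coe z =>
      have h : ContinuousAt (fun w : ℂ => w) z := continuousAt_id
      exact (continuousAt_coe.2 h).continuousWithinAt
  continuousOn_invFun := continuous_coe.continuousOn

/-- The map `w ↦ 1 / w` from `ℂ` to `ℙ¹`, with `0 ↦ ∞`. -/
noncomputable def invCoe (w : ℂ) : P1 := open Classical in if w = 0 then infty else ((w⁻¹ : ℂ) : P1)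

theorem invCoe_zero : invCoe 0 = infty := by simp [invCoe]

theorem invCoe_of_ne {w : ℂ} (hw : w ≠ 0) : invCoe w = ((w⁻¹ : ℂ) : P1) := by simp [invCoe, hw]

theorem continuous_invCoe : Continuous invCoe := by
  rw [continuous_iff_continuousAt]
  intro w
  by_cases hw : w = 0
  · subst hw
    rw [continuousAt_iff_punctured_nhds, invCoe_zero]
    have h : Filter.Tendsto (fun w : ℂ => ((w⁻¹ : ℂ) : P1)) (𝓝[≠] 0) (𝓝 infty) := by
      refine tendsto_coe_infty.comp ?_
      rw [Filter.coclosedCompact_eq_cocompact, ← Metric.cobounded_eq_cocompact]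
      exact Filter.tendsto_inv₀_nhdsNE_zero
    refine h.congr' ?_
    filter_upwards [self_mem_nhdsWithin] with x hx
    exact (invCoe_of_ne hx).symm
  · have h : ContinuousAt (fun w : ℂ => ((w⁻¹ : ℂ) : P1)) w :=
      continuous_coe.continuousAt.comp (continuousAt_inv₀ hw)
    refine h.congr ?_
    filter_upwards [isOpen_ne.mem_nhds hw] with x hx
    exact (invCoe_of_ne hx).symm

/-- The coordinate `w = 1 / z` on `ℙ¹ ∖ {0}`, with `w(∞) = 0`. -/
noncomputable def inftyChart : OpenPartialHomeomorph P1 ℂ where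
  toFun x := x.elim 0 fun z => z⁻¹
  invFun := invCoe
  source := {((0 : ℂ) : P1)}ᶜ
  target := Set.univ
  map_source' _ _ := Set.mem_univ _
  map_target' w _ := by
    by_cases hw : w = 0
    · simp [hw, invCoe_zero]
    · simp [invCoe_of_ne hw, hw]
  left_inv' x hx := by
    induction x using OnePoint.rec with
    | infty => simp [invCoe_zero]
    | coe z =>
      have hz : z ≠ 0 := fun h => hx (by simp [h])
      simp [invCoe_of_ne (inv_ne_zero hz)]
  right_inv' w _ := by
    by_cases hw : w = 0
    · simp [hw, invCoe_zero]
    · simp [invCoe_of_ne hw]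
  open_source := isClosed_singleton.isOpen_compl
  open_target := isOpen_univ
  continuousOn_toFun x hx := by
    refine ContinuousAt.continuousWithinAt ?_
    induction x using OnePoint.rec with
    | infty =>
      rw [continuousAt_infty', Filter.coclosedCompact_eq_cocompact,
        ← Metric.cobounded_eq_cocompact]
      exact Filter.tendsto_inv₀_cobounded
    | coe z =>
      have hz : z ≠ 0 := fun h => hx (by simp [h])
      exact continuousAt_coe.2 (continuousAt_inv₀ hz)
  continuousOn_invFun := continuous_invCoe.continuousOn

theorem affineChart_coe (z : ℂ) : affineChart (z : P1) = z := rfl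

theorem affineChart_symm_apply (z : ℂ) : affineChart.symm z = (z : P1) := rfl

theorem affineChart_source : affineChart.source = {infty}ᶜ := rfl

theorem inftyChart_coe (z : ℂ) : inftyChart (z : P1) = z⁻¹ := rfl

theorem inftyChart_symm_apply (w : ℂ) : inftyChart.symm w = invCoe w := rfl

theorem inftyChart_source : inftyChart.source = {((0 : ℂ) : P1)}ᶜ := rfl

/-- The atlas of `ℙ¹` given by the two standard coordinates `z` and `w = 1 / z`. -/
noncomputable instance : ChartedSpace ℂ P1 where
  atlas := {affineChart, inftyChart}
  chartAt x := open Classical in if x = infty then inftyChart else affineChart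
  mem_chart_source x := by
    by_cases hx : x = infty
    · simp [hx, inftyChart_source]
    · simp [hx, affineChart_source]
  chart_mem_atlas x := by
    by_cases hx : x = infty
    · simp [hx]
    · simp [hx]

/-- With this atlas `ℙ¹` is a Riemann surface. -/
instance : IsManifold 𝓘(ℂ) ω P1 := by
  apply isManifold_of_contDiffOn
  rintro e e' (rfl | rfl) (rfl | rfl)
  · exact contDiffOn_id.congr fun z _ => affineChart.right_inv (Set.mem_univ z)
  · have h : ContDiffOn ℂ ω (fun z : ℂ => z⁻¹) {z | z ≠ 0} :=
      fun z hz => (contDiffAt_inv ℂ hz).contDiffWithinAt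
    have hs : ∀ z, z ∈ (𝓘(ℂ).symm ⁻¹' (affineChart.symm ≫ₕ inftyChart).source ∩
        Set.range 𝓘(ℂ)) → z ≠ 0 := by
      rintro z ⟨hz, -⟩ rfl
      simp [affineChart_symm_apply, inftyChart_source] at hz
    exact (h.mono hs).congr fun z hz => by
      simp [affineChart_symm_apply, inftyChart_coe]
  · have h : ContDiffOn ℂ ω (fun z : ℂ => z⁻¹) {z | z ≠ 0} :=
      fun z hz => (contDiffAt_inv ℂ hz).contDiffWithinAt
    have hs : ∀ z, z ∈ (𝓘(ℂ).symm ⁻¹' (inftyChart.symm ≫ₕ affineChart).source ∩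
        Set.range 𝓘(ℂ)) → z ≠ 0 := by
      rintro z ⟨hz, -⟩ rfl
      simp [affineChart_source, inftyChart_symm_apply, invCoe_zero] at hz
    refine (h.mono hs).congr fun z hz => ?_
    simp [affineChart_coe, inftyChart_symm_apply, invCoe_of_ne (hs z hz)]
  · refine contDiffOn_id.congr fun z _ => ?_
    exact inftyChart.right_inv (Set.mem_univ z)

end P1

/-! ### Special Kähler structures in a holomorphic coordinate

A point of a coordinate domain and a real tangent vector at it are both complex numbers
`x + i y`; the complex structure `I` on tangent vectors is multiplication by `Complex.I`.
A Riemannian metric is its coefficient field `g`, and a connection is its connection form `Γ` in the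
trivialization `(∂ₓ, ∂_y)`: `(∇_v Y)(z) = (D_v Y)(z) + Γ z v (Y z)`. -/

namespace SpecialKahler

/-- The form `ω(v, w) = g(I v, w)`. -/
noncomputable def kahlerForm (g : ℂ → ℂ →L[ℝ] ℂ →L[ℝ] ℝ) (z v w : ℂ) : ℝ :=
  g z (Complex.I * v) w

/-- The tensor `(∇_v I) w = ∇_v (I w) - I (∇_v w)`. -/
noncomputable def nablaI (Γ : ℂ → ℂ →L[ℝ] ℂ →L[ℝ] ℂ) (z v w : ℂ) : ℂ :=
  Γ z v (Complex.I * w) - Complex.I * Γ z v w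

/-- `(g, ∇)` is an (affine) special Kähler structure on the open set `Ω ⊆ ℂ`, with respect to the
complex structure of `ℂ`. -/
structure IsSpecialKahlerOn (Ω : Set ℂ) (g : ℂ → ℂ →L[ℝ] ℂ →L[ℝ] ℝ)
    (Γ : ℂ → ℂ →L[ℝ] ℂ →L[ℝ] ℂ) : Prop where
  smooth_metric : ContDiffOn ℝ ∞ g Ω
  smooth_connection : ContDiffOn ℝ ∞ Γ Ω
  metric_symm : ∀ z ∈ Ω, ∀ v w, g z v w = g z w v
  metric_pos : ∀ z ∈ Ω, ∀ v, v ≠ 0 → 0 < g z v v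
  /-- `g` is Hermitian. -/
  hermitian : ∀ z ∈ Ω, ∀ v w, g z (Complex.I * v) (Complex.I * w) = g z v w
  /-- `dω = 0`. -/
  closed : ∀ z ∈ Ω, ∀ u v w,
    fderiv ℝ (fun x => kahlerForm g x v w) z u + fderiv ℝ (fun x => kahlerForm g x w u) z v
      + fderiv ℝ (fun x => kahlerForm g x u v) z w = 0
  torsion_free : ∀ z ∈ Ω, ∀ v w, Γ z v w = Γ z w v
  /-- The curvature `R(u, v) w = ∇_u ∇_v w - ∇_v ∇_u w` (on constant fields) vanishes. -/
  flat : ∀ z ∈ Ω, ∀ u v w,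
    (fderiv ℝ Γ z u v w + Γ z u (Γ z v w)) - (fderiv ℝ Γ z v u w + Γ z v (Γ z u w)) = 0
  /-- `∇ω = 0`. -/
  symplectic : ∀ z ∈ Ω, ∀ u v w,
    fderiv ℝ (fun x => kahlerForm g x v w) z u
      = kahlerForm g z (Γ z u v) w + kahlerForm g z v (Γ z u w)
  /-- `(∇_v I) w = (∇_w I) v`. -/
  special : ∀ z ∈ Ω, ∀ v w, nablaI Γ z v w = nablaI Γ z w v

/-- The associated cubic form `Ξ(X, Y, Z) = -ω(π X, (∇_Y π) Z)`, where
`π = (1 - √-1 I) / 2 : TΣ ⊗ ℂ → T^{1,0}Σ` is the projection and `ω` is extended complex bilinearly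
to `TΣ ⊗ ℂ`. As `∇_Y π = -(√-1 / 2) ∇_Y I`, this is
`(ω(I X, A) + √-1 ω(X, A)) / 4` with `A = (∇_Y I) Z`. -/
noncomputable def cubicForm (g : ℂ → ℂ →L[ℝ] ℂ →L[ℝ] ℝ) (Γ : ℂ → ℂ →L[ℝ] ℂ →L[ℝ] ℂ)
    (z X Y Z : ℂ) : ℂ :=
  ((kahlerForm g z (Complex.I * X) (nablaI Γ z Y Z) : ℂ)
    + Complex.I * (kahlerForm g z X (nablaI Γ z Y Z) : ℂ)) / 4

end SpecialKahler

open SpecialKahler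

/-! ### Special Kähler structures on Riemann surfaces -/

/-- An (affine) special Kähler structure `(g, ∇)` on the open subset `U` of the Riemann surface `M`:
a special Kähler structure in each chart of the atlas, such that under each change of coordinates
`φ = e' ∘ e⁻¹` the metrics transform as tensors and the connection forms as connection forms. -/
structure SpecialKahlerStructure (M : Type*) [TopologicalSpace M] [ChartedSpace ℂ M]
    [IsManifold 𝓘(ℂ) ω M] (U : Set M) where
  /-- The coefficients of the metric in each chart. -/
  metric : OpenPartialHomeomorph M ℂ → ℂ → ℂ →L[ℝ] ℂ →L[ℝ] ℝ
  /-- The connection form in each chart. -/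
  connection : OpenPartialHomeomorph M ℂ → ℂ → ℂ →L[ℝ] ℂ →L[ℝ] ℂ
  isSpecialKahlerOn : ∀ e ∈ atlas ℂ M,
    IsSpecialKahlerOn (e.target ∩ e.symm ⁻¹' U) (metric e) (connection e)
  metric_change : ∀ e ∈ atlas ℂ M, ∀ e' ∈ atlas ℂ M,
    ∀ z ∈ e.target ∩ e.symm ⁻¹' (U ∩ e'.source), ∀ v w : ℂ,
      metric e z v w = metric e' ((e' ∘ e.symm) z)
        (deriv (e' ∘ e.symm) z * v) (deriv (e' ∘ e.symm) z * w)
  connection_change : ∀ e ∈ atlas ℂ M, ∀ e' ∈ atlas ℂ M,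
    ∀ z ∈ e.target ∩ e.symm ⁻¹' (U ∩ e'.source), ∀ v w : ℂ,
      deriv (e' ∘ e.symm) z * connection e z v w
        = connection e' ((e' ∘ e.symm) z)
            (deriv (e' ∘ e.symm) z * v) (deriv (e' ∘ e.symm) z * w)
          + deriv (deriv (e' ∘ e.symm)) z * v * w

namespace SpecialKahlerStructure

/-- The coefficient `Ξ₀` of the associated cubic form `Ξ = Ξ₀ dz³` in the chart `e`, that is,
`Ξ(∂ₓ, ∂ₓ, ∂ₓ)`. -/
noncomputable def cubicCoeff {M : Type*} [TopologicalSpace M] [ChartedSpace ℂ M]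
    [IsManifold 𝓘(ℂ) ω M] {U : Set M} (σ : SpecialKahlerStructure M U)
    (e : OpenPartialHomeomorph M ℂ) (z : ℂ) : ℂ :=
  cubicForm (σ.metric e) (σ.connection e) z 1 1 1

/-- The associated cubic form does not vanish identically on `U`. -/
def CubicFormNontrivial {M : Type*} [TopologicalSpace M] [ChartedSpace ℂ M]
    [IsManifold 𝓘(ℂ) ω M] {U : Set M} (σ : SpecialKahlerStructure M U) : Prop :=
  ∃ e ∈ atlas ℂ M, ∃ z ∈ e.target ∩ e.symm ⁻¹' U, σ.cubicCoeff e z ≠ 0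

/-- The associated cubic form is meromorphic on all of `M` (where `M ∖ U` is discrete; the values
at the points of `M ∖ U` are immaterial). -/
def CubicFormMeromorphic {M : Type*} [TopologicalSpace M] [ChartedSpace ℂ M]
    [IsManifold 𝓘(ℂ) ω M] {U : Set M} (σ : SpecialKahlerStructure M U) : Prop :=
  ∀ e ∈ atlas ℂ M, ∀ z ∈ e.target, MeromorphicAt (σ.cubicCoeff e) z

/-- `σ` on `U` is the restriction of a special Kähler structure on `V ⊇ U`. -/
def ExtendsTo {M : Type*} [TopologicalSpace M] [ChartedSpace ℂ M]
    [IsManifold 𝓘(ℂ) ω M] {U : Set M} (σ : SpecialKahlerStructure M U) (V : Set M) : Prop :=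
  ∃ τ : SpecialKahlerStructure M V, ∀ e ∈ atlas ℂ M, ∀ z ∈ e.target ∩ e.symm ⁻¹' U,
    τ.metric e z = σ.metric e z ∧ τ.connection e z = σ.connection e z

/-- The singular points of `σ` (where `M ∖ U` is closed and discrete): the points over which `σ` does
not extend as a (smooth) special Kähler structure. They lie in `M ∖ U`. -/
def singularPoints {M : Type*} [TopologicalSpace M] [ChartedSpace ℂ M]
    [IsManifold 𝓘(ℂ) ω M] {U : Set M} (σ : SpecialKahlerStructure M U) : Set M :=
  {p | ¬ σ.ExtendsTo (insert p U)}

end SpecialKahlerStructure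

/-!
A special Kähler structure in a holomorphic coordinate has a connection form of the shape
`Γ(v, w) = A v w + C v̄ w̄`: torsion-freeness and the symmetry of `∇I` exclude all other terms
(`IsSpecialKahlerOn.connection_eq`). Flatness then says
`(∂ₓ + i ∂_y) A = -2 |C|²` and `(∂ₓ - i ∂_y) C = -2 A C`, whence `Δ log |C| = 4 |C|²` where `C ≠ 0`.
Since `(∇_v I) w = -2 i C v̄ w̄`, the number `|(∇_∂ₓ I) ∂ₓ| = 2 |C|` is the length density of a
conformal metric `2 |C| |dz|`, invariant under changes of coordinates, whose curvature is `-1` off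
its zeros. The cubic form is `-(i / 2) λ C̄ dz³`, with `λ = g(∂ₓ, ∂ₓ)`, so it vanishes where `C`
does.

This density continues over every nonsingular point of the structure. If there are at most two
singular points, choose distinct `p` and `q` such that it is defined on `ℙ¹ ∖ {p, q}`. This
surface is parabolic, so by the argument of the Ahlfors–Schwarz lemma the density vanishes
identically, and with it the cubic form. In detail, let `w = (a z + b) / (c z + d)` be a
coordinate with zero at `p` and pole at `q`. For `ε > 0` the function `2 |C| |w / w'| cos (ε log
|w|)` compares the density with `ε |w' / w| / cos (ε log |w|)`, the density of the complete metric
of curvature `-1` on the annulus `|log |w|| < π / (2 ε)`. It does not depend on the coordinate `z`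
and vanishes on the boundary of the annulus; at an interior maximum, the second derivative test
bounds it by `ε` (`le_of_isLocalMax`). Hence it is at most `ε` on the annulus (`barrier_le`), and
letting `ε` tend to `0` gives `C = 0` (`eq_zero_of_isSpecialNormAt`).
-/

namespace SpecialKahler

open ComplexConjugate Filter

/-! ### The second derivative test along lines -/

theorem nonpos_of_isLocalMax_of_hasDerivAt {f f' : ℝ → ℝ} {x c : ℝ} (hmax : IsLocalMax f x)
    (hf : ∀ᶠ t in 𝓝 x, HasDerivAt f (f' t) t) (hf' : HasDerivAt f' c x) : c ≤ 0 := by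
  by_contra! hc
  have he : deriv f =ᶠ[𝓝 x] f' := hf.mono fun t ht => ht.deriv
  -- If `c > 0`, then `x` is also a local minimum, so `f` is locally constant and `c = 0`.
  have hmin : IsLocalMin f x := isLocalMin_of_deriv_deriv_pos
    (by rwa [he.deriv_eq, hf'.deriv]) hmax.deriv_eq_zero hf.self_of_nhds.continuousAt
  have hconst : f =ᶠ[𝓝 x] fun _ => f x := by
    filter_upwards [hmax, hmin] with t h₁ h₂ using le_antisymm h₁ h₂
  have h0 : deriv (deriv f) x = 0 := by
    have h1 : deriv f =ᶠ[𝓝 x] fun _ => 0 := by simpa using hconst.deriv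
    simpa using h1.deriv_eq
  rw [he.deriv_eq, hf'.deriv] at h0
  exact hc.ne' h0

theorem hasDerivAt_log_norm {c : ℝ → ℂ} {c' : ℂ} {t : ℝ} (hc : HasDerivAt c c' t)
    (h0 : c t ≠ 0) : HasDerivAt (fun s => Real.log ‖c s‖) (c' / c t).re t := by
  have hpos : 0 < ‖c t‖ ^ 2 := by positivity
  have h := (hc.norm_sq.log hpos.ne').div_const 2
  refine (h.congr_deriv ?_).congr_of_eventuallyEq (Eventually.of_forall fun s => ?_)
  · rw [Complex.div_re, Complex.inner, ← Complex.normSq_eq_norm_sq]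
    have : Complex.normSq (c t) ≠ 0 := by simpa using h0
    simp only [Complex.mul_re, Complex.conj_re, Complex.conj_im]
    field_simp
    ring
  · simp [Real.log_pow]

theorem hasDerivAt_re_div {c c₁ : ℝ → ℂ} {c₂ : ℂ} {t : ℝ} (hc : HasDerivAt c (c₁ t) t)
    (hc₁ : HasDerivAt c₁ c₂ t) (h0 : c t ≠ 0) :
    HasDerivAt (fun s => (c₁ s / c s).re) ((c₂ * c t - c₁ t * c₁ t) / c t ^ 2).re t :=
  Complex.reCLM.hasFDerivAt.comp_hasDerivAt t (hc₁.div hc h0)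

/-- The derivative of the restriction of `G` to the line `z + ℝ u`. -/
theorem hasDerivAt_line {G : ℂ → ℂ} {G' : ℂ →L[ℝ] ℂ} {z u : ℂ} {t : ℝ}
    (h : HasFDerivAt G G' (z + t * u)) : HasDerivAt (fun s : ℝ => G (z + s * u)) (G' u) t := by
  have hl : HasDerivAt (fun s : ℝ => z + s * u) u t := by
    simpa using ((Complex.ofRealCLM.hasDerivAt (x := t)).mul_const u).const_add z
  exact h.comp_hasDerivAt t hl

theorem tendsto_line (z u : ℂ) : Tendsto (fun s : ℝ => z + s * u) (𝓝 0) (𝓝 z) := by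
  have : Continuous fun s : ℝ => z + s * u := by fun_prop
  simpa using this.tendsto 0

/-- The second derivative test, along the line `z + ℝ u`, for the function
`log (|C| / |κ| * cos (ε h))`, where `C₁` and `C₂` are the first two derivatives of `C` along this
line, likewise for `κ`, and `h` has derivative `Re (u κ)`. -/
theorem line_second_derivative_le {C C₁ κ κ₁ : ℂ → ℂ} {C₂ κ₂ : ℂ} {h : ℂ → ℝ} {z u : ℂ} {ε : ℝ}
    (hC : ∀ᶠ x in 𝓝 z, ∀ t : ℝ, x = z + t * u →
      HasDerivAt (fun s : ℝ => C (z + s * u)) (C₁ x) t)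
    (hC₁ : HasDerivAt (fun s : ℝ => C₁ (z + s * u)) C₂ 0)
    (hκ : ∀ᶠ x in 𝓝 z, ∀ t : ℝ, x = z + t * u →
      HasDerivAt (fun s : ℝ => κ (z + s * u)) (κ₁ x) t)
    (hκ₁ : HasDerivAt (fun s : ℝ => κ₁ (z + s * u)) κ₂ 0)
    (hh : ∀ᶠ x in 𝓝 z, ∀ t : ℝ, x = z + t * u →
      HasDerivAt (fun s : ℝ => h (z + s * u)) (u * κ x).re t)
    (hC0 : C z ≠ 0) (hκ0 : κ z ≠ 0) (hcos : 0 < Real.cos (ε * h z))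
    (hmax : IsLocalMax (fun x => ‖C x‖ / ‖κ x‖ * Real.cos (ε * h x)) z) :
    ((C₂ * C z - C₁ z * C₁ z) / C z ^ 2).re - ((κ₂ * κ z - κ₁ z * κ₁ z) / κ z ^ 2).re
      - (ε ^ 2 * (u * κ z).re ^ 2 / Real.cos (ε * h z) ^ 2
        + ε * Real.tan (ε * h z) * (u * κ₁ z).re) ≤ 0 := by
  have hl := tendsto_line z u
  have e0 : z + ((0 : ℝ) : ℂ) * u = z := by simp
  have dC0 := hC.self_of_nhds 0 e0.symm
  have dκ0 := hκ.self_of_nhds 0 e0.symm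
  have dh0 := hh.self_of_nhds 0 e0.symm
  have cC : ∀ᶠ t : ℝ in 𝓝 0, C (z + t * u) ≠ 0 :=
    dC0.continuousAt.eventually_ne (by simpa using hC0)
  have cκ : ∀ᶠ t : ℝ in 𝓝 0, κ (z + t * u) ≠ 0 :=
    dκ0.continuousAt.eventually_ne (by simpa using hκ0)
  have ch : ∀ᶠ t : ℝ in 𝓝 0, 0 < Real.cos (ε * h (z + t * u)) := by
    have : ContinuousAt (fun t : ℝ => Real.cos (ε * h (z + t * u))) 0 :=
      Real.continuous_cos.continuousAt.comp (continuousAt_const.mul dh0.continuousAt)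
    exact this.eventually (lt_mem_nhds (by simpa using hcos))
  refine nonpos_of_isLocalMax_of_hasDerivAt (x := 0)
    (f := fun t : ℝ => Real.log ‖C (z + t * u)‖ - Real.log ‖κ (z + t * u)‖
      + Real.log (Real.cos (ε * h (z + t * u))))
    (f' := fun t : ℝ => (C₁ (z + t * u) / C (z + t * u)).re - (κ₁ (z + t * u) / κ (z + t * u)).re
      - ε * Real.tan (ε * h (z + t * u)) * (u * κ (z + t * u)).re) ?_ ?_ ?_
  · have hm := hl.eventually hmax
    filter_upwards [hm, cC, cκ, ch] with t ht h₁ h₂ h₃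
    have key : ∀ x, C x ≠ 0 → κ x ≠ 0 → 0 < Real.cos (ε * h x) →
        Real.log ‖C x‖ - Real.log ‖κ x‖ + Real.log (Real.cos (ε * h x))
          = Real.log (‖C x‖ / ‖κ x‖ * Real.cos (ε * h x)) := fun x a b c => by
      rw [Real.log_mul (div_ne_zero (norm_ne_zero_iff.2 a) (norm_ne_zero_iff.2 b)) c.ne',
        Real.log_div (norm_ne_zero_iff.2 a) (norm_ne_zero_iff.2 b)]
    simp only [e0]
    rw [key _ h₁ h₂ h₃, key _ hC0 hκ0 hcos]
    refine Real.log_le_log ?_ ht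
    have := norm_pos_iff.2 h₁
    have := norm_pos_iff.2 h₂
    positivity
  · filter_upwards [hl.eventually hC, hl.eventually hκ, hl.eventually hh, cC, cκ, ch] with
      t dC dκ dh h₁ h₂ h₃
    have d₃ := ((dh t rfl).const_mul ε).cos.log h₃.ne'
    refine (((hasDerivAt_log_norm (dC t rfl) h₁).sub
      (hasDerivAt_log_norm (dκ t rfl) h₂)).add d₃).congr_deriv ?_
    rw [Real.tan_eq_sin_div_cos]
    ring
  · have d₁ := hasDerivAt_re_div (c₁ := fun t : ℝ => C₁ (z + t * u)) (t := 0)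
      (by simpa using dC0) hC₁ (by simpa using hC0)
    have d₂ := hasDerivAt_re_div (c₁ := fun t : ℝ => κ₁ (z + t * u)) (t := 0)
      (by simpa using dκ0) hκ₁ (by simpa using hκ0)
    have hcos' : Real.cos (ε * h (z + ((0 : ℝ) : ℂ) * u)) ≠ 0 := by simpa using hcos.ne'
    have d₃ := ((Real.hasDerivAt_tan hcos').comp (0 : ℝ) (dh0.const_mul ε)).const_mul ε
    have d₄ : HasDerivAt (fun t : ℝ => (u * κ (z + t * u)).re) (u * κ₁ z).re 0 :=
      Complex.reCLM.hasFDerivAt.comp_hasDerivAt 0 (dκ0.const_mul u)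
    refine ((d₁.sub d₂).sub (d₃.mul d₄)).congr_deriv ?_
    simp only [e0, Function.comp]
    ring

/-! ### The curvature estimate at a maximum -/

/-- If `(∂ₓ + i ∂_y) A = -2 |C|²` and `(∂ₓ - i ∂_y) C = -2 A C`, then `Δ log |C| = 4 |C|²`. For `κ`
holomorphic and `h` with `dh = Re (κ dz)`, the function `log |κ|` is harmonic and
`Δ log cos (ε h) = -ε² |κ|² / cos² (ε h)`, so `Δ log (|C| / |κ| * cos (ε h)) ≤ 0` at a maximum gives
the bound. -/
theorem le_of_isLocalMax {A C κ : ℂ → ℂ} {h : ℂ → ℝ} {z : ℂ} {ε : ℝ} (hε : 0 < ε)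
    (hC : ContDiffAt ℝ 2 C z) (hA : DifferentiableAt ℝ A z)
    (hCz : ∀ᶠ x in 𝓝 z,
      fderiv ℝ C x 1 - Complex.I * fderiv ℝ C x Complex.I = -2 * (A x * C x))
    (hAz : fderiv ℝ A z 1 + Complex.I * fderiv ℝ A z Complex.I = -2 * (C z * conj (C z)))
    (hκ : AnalyticAt ℂ κ z)
    (hh : ∀ᶠ x in 𝓝 z, HasFDerivAt h (Complex.reCLM ∘L
      ((ContinuousLinearMap.mul ℂ ℂ (κ x)).restrictScalars ℝ)) x)
    (hC0 : C z ≠ 0) (hκ0 : κ z ≠ 0) (hcos : 0 < Real.cos (ε * h z))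
    (hmax : IsLocalMax (fun x => ‖C x‖ / ‖κ x‖ * Real.cos (ε * h x)) z) :
    2 * ‖C z‖ / ‖κ z‖ * Real.cos (ε * h z) ≤ ε := by
  have hdC : ∀ᶠ x in 𝓝 z, DifferentiableAt ℝ C x :=
    (hC.eventually (by simp)).mono fun x hx => hx.differentiableAt (by simp)
  have hd2 : DifferentiableAt ℝ (fderiv ℝ C) z :=
    (hC.fderiv_right (m := 1) (by norm_num)).differentiableAt (by simp)
  have hsymm : IsSymmSndFDerivAt ℝ C z := hC.isSymmSndFDerivAt (by simp)
  have key : ∀ u : ℂ, _ := fun u => line_second_derivative_le (C := C) (κ := κ) (h := h)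
    (z := z) (u := u) (ε := ε) (C₁ := fun x => fderiv ℝ C x u) (κ₁ := fun x => u * deriv κ x)
    (C₂ := fderiv ℝ (fderiv ℝ C) z u u) (κ₂ := u ^ 2 * deriv (deriv κ) z)
    (hdC.mono fun x hx t ht => by
      subst ht; exact hasDerivAt_line hx.hasFDerivAt)
    (by
      have := hd2.hasFDerivAt.clm_apply (hasFDerivAt_const u z)
      refine (hasDerivAt_line (t := 0) (by simpa using this)).congr_deriv ?_
      simp)
    (hκ.eventually_analyticAt.mono fun x hx t ht => by
      subst ht
      refine (hasDerivAt_line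
        hx.differentiableAt.hasDerivAt.complexToReal_fderiv).congr_deriv ?_
      simp [mul_comm])
    (by
      have := (hκ.deriv.differentiableAt.hasDerivAt.const_mul u).complexToReal_fderiv
      refine (hasDerivAt_line (t := 0) (by simpa using this)).congr_deriv ?_
      simp; ring)
    (hh.mono fun x hx t ht => by
      subst ht
      have hl : HasDerivAt (fun s : ℝ => z + s * u) u t := by
        simpa using ((Complex.ofRealCLM.hasDerivAt (x := t)).mul_const u).const_add z
      refine (hx.comp_hasDerivAt t hl).congr_deriv ?_
      simp [mul_comm])
    hC0 hκ0 hcos hmax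
  -- The Laplacian is the sum of the second derivatives in the directions `1` and `i`.
  have hsum := add_le_add (key 1) (key Complex.I)
  have hI := Complex.I_sq
  set Cx := fderiv ℝ C z 1
  set Cy := fderiv ℝ C z Complex.I
  have hCz0 : Cx - Complex.I * Cy = -2 * (A z * C z) := hCz.self_of_nhds
  have hdiff : ∀ u : ℂ, fderiv ℝ (fderiv ℝ C) z u 1
      - Complex.I * fderiv ℝ (fderiv ℝ C) z u Complex.I
      = -2 * (A z * fderiv ℝ C z u + fderiv ℝ A z u * C z) := by
    intro u
    have h1 : HasFDerivAt (fun x => fderiv ℝ C x 1 - Complex.I * fderiv ℝ C x Complex.I) _ z :=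
      (hd2.hasFDerivAt.clm_apply (hasFDerivAt_const (1 : ℂ) z)).sub
        ((hd2.hasFDerivAt.clm_apply (hasFDerivAt_const Complex.I z)).const_mul Complex.I)
    have h2 : HasFDerivAt (fun x => -2 * (A x * C x)) _ z :=
      (hA.hasFDerivAt.mul hdC.self_of_nhds.hasFDerivAt).const_mul (-2)
    have h3 := congrArg (fun T : ℂ →L[ℝ] ℂ => T u) (h1.unique (h2.congr_of_eventuallyEq hCz))
    simp at h3
    linear_combination h3
  have hxx := hdiff 1
  have hyy := hdiff Complex.I
  have hxy : fderiv ℝ (fderiv ℝ C) z 1 Complex.I = fderiv ℝ (fderiv ℝ C) z Complex.I 1 :=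
    hsymm 1 Complex.I
  -- The value of `Δ log C`, in which the equations and the symmetry of `D²C` enter.
  have hlap : (fderiv ℝ (fderiv ℝ C) z 1 1 * C z - Cx * Cx) / C z ^ 2
      + (fderiv ℝ (fderiv ℝ C) z Complex.I Complex.I * C z - Cy * Cy) / C z ^ 2
      = 4 * (C z * conj (C z)) := by
    rw [← add_div, div_eq_iff (pow_ne_zero 2 hC0)]
    change _ = -2 * (A z * Cx + _) at hxx
    change _ = -2 * (A z * Cy + _) at hyy
    linear_combination (C z) * hxx + Complex.I * (C z) * hyy + Complex.I * (C z) * hxy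
      - 2 * (C z) ^ 2 * hAz - (Cx + Complex.I * Cy) * hCz0
      + (C z * fderiv ℝ (fderiv ℝ C) z Complex.I Complex.I - Cy ^ 2) * hI
  have hlap' := congrArg Complex.re hlap
  have hkap : (1 ^ 2 * deriv (deriv κ) z * κ z - 1 * deriv κ z * (1 * deriv κ z)) / κ z ^ 2
      + (Complex.I ^ 2 * deriv (deriv κ) z * κ z
        - Complex.I * deriv κ z * (Complex.I * deriv κ z)) / κ z ^ 2 = 0 := by
    rw [← add_div, div_eq_zero_iff]
    left
    linear_combination (deriv (deriv κ) z * κ z - deriv κ z ^ 2) * hI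
  have hkap' := congrArg Complex.re hkap
  have hk1 : (1 * (1 * deriv κ z)).re + (Complex.I * (Complex.I * deriv κ z)).re = 0 := by
    simp
  have hk2 : (1 * κ z).re ^ 2 + (Complex.I * κ z).re ^ 2 = ‖κ z‖ ^ 2 := by
    rw [← Complex.normSq_eq_norm_sq, Complex.normSq_apply]
    simp
    ring
  have hCC : (4 * (C z * conj (C z))).re = 4 * ‖C z‖ ^ 2 := by
    rw [Complex.mul_conj, ← Complex.normSq_eq_norm_sq]
    norm_num [Complex.mul_re]
  rw [Complex.add_re, hCC] at hlap'
  rw [Complex.add_re, Complex.zero_re] at hkap'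
  have hfin : 4 * ‖C z‖ ^ 2 ≤ ε ^ 2 * ‖κ z‖ ^ 2 / Real.cos (ε * h z) ^ 2 := by
    rw [← hk2, mul_add, add_div]
    have e : ε * Real.tan (ε * h z) * (1 * (1 * deriv κ z)).re
      + ε * Real.tan (ε * h z) * (Complex.I * (Complex.I * deriv κ z)).re = 0 := by
      rw [← mul_add, hk1, mul_zero]
    linarith
  have hκn : 0 < ‖κ z‖ := norm_pos_iff.2 hκ0
  rw [le_div_iff₀ (by positivity)] at hfin
  have h5 : 2 * ‖C z‖ * Real.cos (ε * h z) ≤ ε * ‖κ z‖ :=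
    le_of_sq_le_sq (by nlinarith) (by positivity)
  rw [div_mul_eq_mul_div, div_le_iff₀ hκn]
  exact h5


/-! ### The structure equations -/

/-- The coefficient `A` of `v w` in a connection form `Γ(v, w) = A v w + C v̄ w̄`. -/
noncomputable def linearPart (Γ : ℂ → ℂ →L[ℝ] ℂ →L[ℝ] ℂ) (z : ℂ) : ℂ :=
  (Γ z 1 1 - Complex.I * Γ z 1 Complex.I) / 2

/-- The coefficient `C` of `v̄ w̄` in a connection form `Γ(v, w) = A v w + C v̄ w̄`. -/
noncomputable def conjPart (Γ : ℂ → ℂ →L[ℝ] ℂ →L[ℝ] ℂ) (z : ℂ) : ℂ :=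
  (Γ z 1 1 + Complex.I * Γ z 1 Complex.I) / 2

theorem clm_apply_eq (T : ℂ →L[ℝ] ℂ) (w : ℂ) : T w = w.re * T 1 + w.im * T Complex.I := by
  have h : w = w.re • (1 : ℂ) + w.im • Complex.I := by simp [Complex.re_add_im]
  calc T w = T (w.re • (1 : ℂ) + w.im • Complex.I) := congrArg T h
    _ = w.re * T 1 + w.im * T Complex.I := by
      rw [map_add, map_smul, map_smul, Complex.real_smul, Complex.real_smul]

namespace IsSpecialKahlerOn

variable {Ω : Set ℂ} {g : ℂ → ℂ →L[ℝ] ℂ →L[ℝ] ℝ} {Γ : ℂ → ℂ →L[ℝ] ℂ →L[ℝ] ℂ} {z : ℂ}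

/-- A torsion-free connection form with symmetric `∇I` is complex bilinear plus conjugate bilinear:
the remaining component `B (v w̄ + v̄ w)` of a symmetric form would contribute the term
`-2 i B v w̄` to `(∇_v I) w`. -/
theorem connection_eq (H : IsSpecialKahlerOn Ω g Γ) (hz : z ∈ Ω) (v w : ℂ) :
    Γ z v w = linearPart Γ z * v * w + conjPart Γ z * conj v * conj w := by
  have h1 := H.torsion_free z hz 1 Complex.I
  have h2 := H.special z hz 1 Complex.I
  have hI := Complex.I_sq
  simp only [nablaI, mul_one, Complex.I_mul_I, map_neg] at h2
  have h3 : Γ z v w = v.re * (w.re * Γ z 1 1 + w.im * Γ z 1 Complex.I)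
      + v.im * (w.re * Γ z Complex.I 1 + w.im * Γ z Complex.I Complex.I) := by
    have e1 := clm_apply_eq ((Γ z).flip 1) v
    have e2 := clm_apply_eq ((Γ z).flip Complex.I) v
    simp only [ContinuousLinearMap.flip_apply] at e1 e2
    rw [clm_apply_eq (Γ z v) w, e1, e2]
    ring
  have hv : conj v = v.re - v.im * Complex.I := by
    apply Complex.ext <;> simp
  have hw : conj w = w.re - w.im * Complex.I := by
    apply Complex.ext <;> simp
  have h4 : Γ z Complex.I Complex.I = -Γ z 1 1 := by
    linear_combination -h2 - Complex.I * h1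
  rw [h3, h4, ← h1, hv, hw]
  conv_rhs => rw [← Complex.re_add_im v, ← Complex.re_add_im w]
  simp only [linearPart, conjPart, Complex.add_re, Complex.add_im, Complex.ofReal_re,
    Complex.ofReal_im, Complex.mul_re, Complex.mul_im, Complex.I_re, Complex.I_im]
  simp only [mul_zero, mul_one, sub_zero, add_zero, zero_add]
  linear_combination (-(v.im : ℂ) * w.im * Γ z 1 1
    + ((v.re : ℂ) * w.im + v.im * w.re) * Γ z 1 Complex.I) * hI

theorem nablaI_eq (H : IsSpecialKahlerOn Ω g Γ) (hz : z ∈ Ω) (v w : ℂ) :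
    nablaI Γ z v w = -2 * Complex.I * conjPart Γ z * conj v * conj w := by
  simp only [nablaI, H.connection_eq hz, map_mul, Complex.conj_I]
  ring

theorem fderiv_connection_apply (H : IsSpecialKahlerOn Ω g Γ) (hΩ : IsOpen Ω) (hz : z ∈ Ω)
    (u v w : ℂ) : fderiv ℝ Γ z u v w = fderiv ℝ (fun x => Γ x v w) z u := by
  have hd : DifferentiableAt ℝ Γ z :=
    (H.smooth_connection.contDiffAt (hΩ.mem_nhds hz)).differentiableAt (by simp)
  have h := (hd.hasFDerivAt.clm_apply (hasFDerivAt_const v z)).clm_apply (hasFDerivAt_const w z)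
  rw [h.fderiv]
  simp

theorem contDiffAt_linearPart (H : IsSpecialKahlerOn Ω g Γ) (hΩ : IsOpen Ω) (hz : z ∈ Ω) :
    ContDiffAt ℝ ∞ (linearPart Γ) z := by
  have h := H.smooth_connection.contDiffAt (hΩ.mem_nhds hz)
  unfold linearPart
  fun_prop

theorem contDiffAt_conjPart (H : IsSpecialKahlerOn Ω g Γ) (hΩ : IsOpen Ω) (hz : z ∈ Ω) :
    ContDiffAt ℝ ∞ (conjPart Γ) z := by
  have h := H.smooth_connection.contDiffAt (hΩ.mem_nhds hz)
  unfold conjPart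
  fun_prop

theorem fderiv_connection_eq (H : IsSpecialKahlerOn Ω g Γ) (hΩ : IsOpen Ω) (hz : z ∈ Ω)
    (u v w : ℂ) : fderiv ℝ Γ z u v w = fderiv ℝ (linearPart Γ) z u * (v * w)
      + fderiv ℝ (conjPart Γ) z u * (conj v * conj w) := by
  have hA := ((H.contDiffAt_linearPart hΩ hz).differentiableAt (by simp)).hasFDerivAt
  have hC := ((H.contDiffAt_conjPart hΩ hz).differentiableAt (by simp)).hasFDerivAt
  have he : (fun x => Γ x v w) =ᶠ[𝓝 z] fun x => linearPart Γ x * (v * w)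
      + conjPart Γ x * (conj v * conj w) := by
    filter_upwards [hΩ.mem_nhds hz] with x hx
    rw [H.connection_eq hx]
    ring
  have h := ((hA.mul_const (v * w)).add
    (hC.mul_const (conj v * conj w))).congr_of_eventuallyEq he
  rw [H.fderiv_connection_apply hΩ hz, h.fderiv]
  simp
  ring

/-- The curvature equation on `(1, i)`, split into its complex linear and conjugate linear parts
in the vector it acts on. -/
theorem flat_one_I (H : IsSpecialKahlerOn Ω g Γ) (hΩ : IsOpen Ω) (hz : z ∈ Ω) :
    (fderiv ℝ (linearPart Γ) z 1 + Complex.I * fderiv ℝ (linearPart Γ) z Complex.I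
      = -2 * (conjPart Γ z * conj (conjPart Γ z))) ∧
    (fderiv ℝ (conjPart Γ) z 1 - Complex.I * fderiv ℝ (conjPart Γ) z Complex.I
      = -2 * (linearPart Γ z * conjPart Γ z)) := by
  have hI := Complex.I_sq
  have h1 := H.flat z hz 1 Complex.I 1
  have h2 := H.flat z hz 1 Complex.I Complex.I
  simp only [H.fderiv_connection_eq hΩ hz, H.connection_eq hz, map_add, map_mul, map_one,
    map_neg, Complex.conj_I, neg_neg] at h1 h2
  constructor
  · linear_combination -(Complex.I * h1 + h2) / 2
      + (fderiv ℝ (linearPart Γ) z 1 + 2 * conjPart Γ z * conj (conjPart Γ z)) * hI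
  · linear_combination (Complex.I * h1 - h2) / 2
      + (fderiv ℝ (conjPart Γ) z 1 + 2 * linearPart Γ z * conjPart Γ z) * hI

theorem fderiv_linearPart (H : IsSpecialKahlerOn Ω g Γ) (hΩ : IsOpen Ω) (hz : z ∈ Ω) :
    fderiv ℝ (linearPart Γ) z 1 + Complex.I * fderiv ℝ (linearPart Γ) z Complex.I
      = -2 * (conjPart Γ z * conj (conjPart Γ z)) :=
  (H.flat_one_I hΩ hz).1

theorem fderiv_conjPart (H : IsSpecialKahlerOn Ω g Γ) (hΩ : IsOpen Ω) (hz : z ∈ Ω) :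
    fderiv ℝ (conjPart Γ) z 1 - Complex.I * fderiv ℝ (conjPart Γ) z Complex.I
      = -2 * (linearPart Γ z * conjPart Γ z) :=
  (H.flat_one_I hΩ hz).2

end IsSpecialKahlerOn

/-! ### The conformal density of a special Kähler structure -/

/-- Near `z`, the function `n` is the length density `|(∇_∂ₓ I) ∂ₓ|` of a special Kähler
structure. -/
def IsSpecialNormAt (n : ℂ → ℝ) (z : ℂ) : Prop :=
  ∃ (Ω : Set ℂ) (g : ℂ → ℂ →L[ℝ] ℂ →L[ℝ] ℝ) (Γ : ℂ → ℂ →L[ℝ] ℂ →L[ℝ] ℂ),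
    IsOpen Ω ∧ z ∈ Ω ∧ IsSpecialKahlerOn Ω g Γ ∧ ∀ x ∈ Ω, n x = ‖nablaI Γ x 1 1‖

theorem IsSpecialKahlerOn.norm_nablaI {Ω : Set ℂ} {g : ℂ → ℂ →L[ℝ] ℂ →L[ℝ] ℝ}
    {Γ : ℂ → ℂ →L[ℝ] ℂ →L[ℝ] ℂ} {z : ℂ} (H : IsSpecialKahlerOn Ω g Γ) (hz : z ∈ Ω) :
    ‖nablaI Γ z 1 1‖ = 2 * ‖conjPart Γ z‖ := by
  simp [H.nablaI_eq hz]

namespace IsSpecialNormAt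

variable {n : ℂ → ℝ} {z : ℂ}

theorem nonneg (H : IsSpecialNormAt n z) : 0 ≤ n z := by
  obtain ⟨Ω, g, Γ, -, hz, -, hn⟩ := H
  rw [hn z hz]
  positivity

theorem continuousAt (H : IsSpecialNormAt n z) : ContinuousAt n z := by
  obtain ⟨Ω, g, Γ, hΩ, hz, hΓ, hn⟩ := H
  have hc : ContinuousAt (fun x => 2 * ‖conjPart Γ x‖) z :=
    continuousAt_const.mul (hΓ.contDiffAt_conjPart hΩ hz).continuousAt.norm
  refine hc.congr ?_
  filter_upwards [hΩ.mem_nhds hz] with x hx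
  rw [hn x hx, hΓ.norm_nablaI hx]

theorem le_of_isLocalMax {κ : ℂ → ℂ} {h : ℂ → ℝ} {ε : ℝ} (hε : 0 < ε) (H : IsSpecialNormAt n z)
    (hκ : AnalyticAt ℂ κ z)
    (hh : ∀ᶠ x in 𝓝 z, HasFDerivAt h (Complex.reCLM ∘L
      ((ContinuousLinearMap.mul ℂ ℂ (κ x)).restrictScalars ℝ)) x)
    (hκ0 : κ z ≠ 0) (hcos : 0 < Real.cos (ε * h z))
    (hmax : IsLocalMax (fun x => n x / ‖κ x‖ * Real.cos (ε * h x)) z) :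
    n z / ‖κ z‖ * Real.cos (ε * h z) ≤ ε := by
  obtain ⟨Ω, g, Γ, hΩ, hz, hΓ, hn⟩ := H
  have hn' : ∀ x ∈ Ω, n x = 2 * ‖conjPart Γ x‖ := fun x hx => by
    rw [hn x hx, hΓ.norm_nablaI hx]
  rw [hn' z hz]
  rcases eq_or_ne (conjPart Γ z) 0 with h0 | h0
  · simpa [h0] using hε.le
  refine SpecialKahler.le_of_isLocalMax hε
    ((hΓ.contDiffAt_conjPart hΩ hz).of_le (WithTop.coe_le_coe.2 le_top))
    ((hΓ.contDiffAt_linearPart hΩ hz).differentiableAt (by simp)) ?_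
    (hΓ.fderiv_linearPart hΩ hz) hκ hh h0 hκ0 hcos ?_
  · filter_upwards [hΩ.mem_nhds hz] with x hx using hΓ.fderiv_conjPart hΩ hx
  · filter_upwards [hmax, hΩ.mem_nhds hz] with x hx hxΩ
    rw [hn' x hxΩ, hn' z hz, mul_div_assoc, mul_assoc, mul_div_assoc, mul_assoc] at hx
    linarith

end IsSpecialNormAt

/-! ### The comparison function on an annulus -/

/-- With `w = (a z + b) / (c z + d)`, this is `d log |w| = Re ((w' / w) dz)`. -/
theorem hasFDerivAt_log_norm_div {a b c d z : ℂ} (h₁ : a * z + b ≠ 0) (h₂ : c * z + d ≠ 0) :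
    HasFDerivAt (fun x => Real.log ‖a * x + b‖ - Real.log ‖c * x + d‖) (Complex.reCLM ∘L
      ((ContinuousLinearMap.mul ℂ ℂ
        ((a * d - b * c) / ((a * z + b) * (c * z + d)))).restrictScalars ℝ)) z := by
  have key : ∀ a b : ℂ, a * z + b ≠ 0 → HasFDerivAt (fun x => Real.log ‖a * x + b‖)
      (Complex.reCLM ∘L ((ContinuousLinearMap.mul ℂ ℂ (a / (a * z + b))).restrictScalars ℝ)) z := by
    intro a b h
    have hl : HasFDerivAt (fun x : ℂ => a * x + b)
        ((ContinuousLinearMap.mul ℂ ℂ a).restrictScalars ℝ) z :=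
      ((ContinuousLinearMap.mul ℂ ℂ a).restrictScalars ℝ).hasFDerivAt.add_const b
    have hpos : 0 < ‖a * z + b‖ ^ 2 := by positivity
    have hf := (hl.norm_sq.log hpos.ne').const_mul (1 / 2)
    refine (hf.congr_fderiv ?_).congr_of_eventuallyEq (Eventually.of_forall fun s => ?_)
    · ext u
      have h0 : Complex.normSq (a * z + b) ≠ 0 := by simpa using h
      rw [← Complex.normSq_eq_norm_sq]
      simp [Complex.inner, Complex.div_re, Complex.div_im]
      field_simp
      ring
    · simp [Real.log_pow]
  refine ((key a b h₁).sub (key c d h₂)).congr_fderiv ?_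
  ext u
  simp only [sub_apply, ContinuousLinearMap.comp_apply,
    ContinuousLinearMap.coe_restrictScalars', ContinuousLinearMap.mul_apply', Complex.reCLM_apply,
    ← Complex.sub_re, ← sub_mul]
  congr 2
  rw [div_sub_div _ _ h₁ h₂]
  congr 1
  ring

/-- With `w = (a z + b) / (c z + d)` this is `n |w / w'| cos (ε log |w|)`, up to the constant factor
`|a d - b c|`. In the coordinate `1 / z` the same function is given by `(b, a, d, c)`. -/
noncomputable def barrier (a b c d : ℂ) (n : ℂ → ℝ) (ε : ℝ) (z : ℂ) : ℝ :=
  n z * (‖a * z + b‖ * ‖c * z + d‖)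
    * Real.cos (ε * (Real.log ‖a * z + b‖ - Real.log ‖c * z + d‖))

/-- The closed annulus `|log |w|| ≤ π / (2 ε)` for `w = (a z + b) / (c z + d)`. -/
def annulus (a b c d : ℂ) (ε : ℝ) : Set ℂ :=
  {z | a * z + b ≠ 0 ∧ c * z + d ≠ 0 ∧
    ε * |Real.log ‖a * z + b‖ - Real.log ‖c * z + d‖| ≤ Real.pi / 2}

/-- In its description by `|a z + b| ≤ E |c z + d|` and `|c z + d| ≤ E |a z + b|`, the annulus is
visibly closed; the zeros of the two forms are excluded as the forms have no common zero. -/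
theorem isCompact_annulus_inter {a b c d : ℂ} (hdet : a * d - b * c ≠ 0) {ε : ℝ} (hε : 0 < ε) :
    IsCompact (annulus a b c d ε ∩ Metric.closedBall 0 1) := by
  have hset : annulus a b c d ε = {z | ‖a * z + b‖ ≤ Real.exp (Real.pi / 2 / ε) * ‖c * z + d‖} ∩
      {z | ‖c * z + d‖ ≤ Real.exp (Real.pi / 2 / ε) * ‖a * z + b‖} := by
    ext z
    simp only [annulus, Set.mem_ofPred_eq, Set.mem_inter_iff]
    have hE := Real.exp_pos (Real.pi / 2 / ε)
    have key : a * z + b ≠ 0 → c * z + d ≠ 0 →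
        (ε * |Real.log ‖a * z + b‖ - Real.log ‖c * z + d‖| ≤ Real.pi / 2 ↔
        ‖a * z + b‖ ≤ Real.exp (Real.pi / 2 / ε) * ‖c * z + d‖ ∧
        ‖c * z + d‖ ≤ Real.exp (Real.pi / 2 / ε) * ‖a * z + b‖) := by
      intro h₁ h₂
      have h₁ := norm_pos_iff.2 h₁
      have h₂ := norm_pos_iff.2 h₂
      rw [← Real.log_le_log_iff h₁ (by positivity), ← Real.log_le_log_iff h₂ (by positivity),
        Real.log_mul hE.ne' h₁.ne', Real.log_mul hE.ne' h₂.ne', Real.log_exp, ← le_div_iff₀' hε,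
        abs_le]
      constructor <;> rintro ⟨h, h'⟩ <;> constructor <;> linarith
    constructor
    · rintro ⟨h₁, h₂, h⟩
      exact (key h₁ h₂).1 h
    · rintro ⟨h, h'⟩
      have h₁ : a * z + b ≠ 0 := fun h₁ => by
        have h₂ : c * z + d = 0 := norm_le_zero_iff.1 (by simpa [h₁] using h')
        exact hdet (by linear_combination (-c) * h₁ + a * h₂)
      have h₂ : c * z + d ≠ 0 := fun h₂ => h₁ (norm_le_zero_iff.1 (by simpa [h₂] using h))
      exact ⟨h₁, h₂, (key h₁ h₂).2 ⟨h, h'⟩⟩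
  rw [hset]
  refine (isCompact_closedBall 0 1).inter_left (IsClosed.inter ?_ ?_)
  · exact isClosed_le (by fun_prop) (by fun_prop)
  · exact isClosed_le (by fun_prop) (by fun_prop)

theorem barrier_le_of_isLocalMax {a b c d z : ℂ} {n : ℂ → ℝ} {ε : ℝ} (hdet : a * d - b * c ≠ 0)
    (hε : 0 < ε) (H : IsSpecialNormAt n z) (h₁ : a * z + b ≠ 0) (h₂ : c * z + d ≠ 0)
    (hcos : 0 < Real.cos (ε * (Real.log ‖a * z + b‖ - Real.log ‖c * z + d‖)))
    (hmax : IsLocalMax (barrier a b c d n ε) z) :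
    barrier a b c d n ε z ≤ ε * ‖a * d - b * c‖ := by
  have hdet' := norm_pos_iff.2 hdet
  have e : ∀ x, n x / ‖(a * d - b * c) / ((a * x + b) * (c * x + d))‖
      * Real.cos (ε * (Real.log ‖a * x + b‖ - Real.log ‖c * x + d‖))
      = barrier a b c d n ε x / ‖a * d - b * c‖ := fun x => by
    rw [barrier, norm_div, norm_mul, div_div_eq_mul_div, div_mul_eq_mul_div]
  have h := H.le_of_isLocalMax (κ := fun x => (a * d - b * c) / ((a * x + b) * (c * x + d)))
    (h := fun x => Real.log ‖a * x + b‖ - Real.log ‖c * x + d‖) hε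
    (analyticAt_const.div (by fun_prop) (mul_ne_zero h₁ h₂)) ?_
    (div_ne_zero hdet (mul_ne_zero h₁ h₂)) hcos ?_
  · rwa [e, div_le_iff₀ hdet'] at h
  · have c₁ : ∀ᶠ x in 𝓝 z, a * x + b ≠ 0 := ContinuousAt.eventually_ne (by fun_prop) h₁
    have c₂ : ∀ᶠ x in 𝓝 z, c * x + d ≠ 0 := ContinuousAt.eventually_ne (by fun_prop) h₂
    filter_upwards [c₁, c₂] with x hx₁ hx₂ using hasFDerivAt_log_norm_div hx₁ hx₂
  · filter_upwards [hmax] with x hx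
    simp only [e]
    gcongr

/-- A positive maximum over the closed annulus is interior, since the cosine vanishes on the
boundary. -/
theorem barrier_le_of_isMaxOn {a b c d z : ℂ} {n : ℂ → ℝ} {ε : ℝ} (hdet : a * d - b * c ≠ 0)
    (hε : 0 < ε) (H : IsSpecialNormAt n z) (hz : z ∈ annulus a b c d ε)
    (hmax : IsMaxOn (barrier a b c d n ε) (annulus a b c d ε) z) :
    barrier a b c d n ε z ≤ ε * ‖a * d - b * c‖ := by
  obtain ⟨h₁, h₂, h⟩ := hz
  rcases le_or_gt (barrier a b c d n ε z) 0 with hle | hlt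
  · exact hle.trans (by positivity)
  have hpos : 0 ≤ n z * (‖a * z + b‖ * ‖c * z + d‖) :=
    mul_nonneg H.nonneg (by positivity)
  have hcos : 0 < Real.cos (ε * (Real.log ‖a * z + b‖ - Real.log ‖c * z + d‖)) :=
    pos_of_mul_pos_right hlt hpos
  have hne : ε * |Real.log ‖a * z + b‖ - Real.log ‖c * z + d‖| ≠ Real.pi / 2 := fun h' => by
    rw [← Real.cos_abs, abs_mul, abs_of_pos hε, h', Real.cos_pi_div_two] at hcos
    exact hcos.false
  refine barrier_le_of_isLocalMax hdet hε H h₁ h₂ hcos ?_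
  have c₁ : ∀ᶠ x in 𝓝 z, a * x + b ≠ 0 := ContinuousAt.eventually_ne (by fun_prop) h₁
  have c₂ : ∀ᶠ x in 𝓝 z, c * x + d ≠ 0 := ContinuousAt.eventually_ne (by fun_prop) h₂
  have c₃ : ContinuousAt
      (fun x => ε * |Real.log ‖a * x + b‖ - Real.log ‖c * x + d‖|) z :=
    continuousAt_const.mul (hasFDerivAt_log_norm_div h₁ h₂).continuousAt.abs
  filter_upwards [c₁, c₂, c₃.eventually (gt_mem_nhds (lt_of_le_of_ne h hne))] with x hx₁ hx₂ hx
  exact hmax ⟨hx₁, hx₂, hx.le⟩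

theorem continuousOn_barrier {a b c d : ℂ} {n : ℂ → ℝ} {ε : ℝ}
    (H : ∀ z, a * z + b ≠ 0 → c * z + d ≠ 0 → IsSpecialNormAt n z) :
    ContinuousOn (barrier a b c d n ε) (annulus a b c d ε) := by
  rintro z ⟨h₁, h₂, -⟩
  refine ContinuousAt.continuousWithinAt (ContinuousAt.mul ?_ ?_)
  · exact (H z h₁ h₂).continuousAt.mul (by fun_prop)
  · exact Real.continuous_cos.continuousAt.comp
      (continuousAt_const.mul (hasFDerivAt_log_norm_div h₁ h₂).continuousAt)

theorem mul_inv_add {a b z : ℂ} (hz : z ≠ 0) : b * z⁻¹ + a = z⁻¹ * (a * z + b) := by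
  field_simp
  ring

theorem mem_annulus_inv {a b c d z : ℂ} {ε : ℝ} (hz : z ≠ 0) (h : z ∈ annulus a b c d ε) :
    z⁻¹ ∈ annulus b a d c ε := by
  obtain ⟨h₁, h₂, h⟩ := h
  have hz' := inv_ne_zero hz
  refine ⟨?_, ?_, ?_⟩
  · rw [mul_inv_add hz]
    exact mul_ne_zero hz' h₁
  · rw [mul_inv_add hz]
    exact mul_ne_zero hz' h₂
  · rwa [mul_inv_add hz, mul_inv_add hz, norm_mul, norm_mul,
      Real.log_mul (norm_ne_zero_iff.2 hz') (norm_ne_zero_iff.2 h₁),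
      Real.log_mul (norm_ne_zero_iff.2 hz') (norm_ne_zero_iff.2 h₂), add_sub_add_left_eq_sub]

theorem barrier_inv {a b c d z : ℂ} {n₁ n₂ : ℂ → ℝ} {ε : ℝ} (hz : z ≠ 0)
    (h₁ : a * z + b ≠ 0) (h₂ : c * z + d ≠ 0) (hn : n₁ z = n₂ z⁻¹ / ‖z‖ ^ 2) :
    barrier b a d c n₂ ε z⁻¹ = barrier a b c d n₁ ε z := by
  have hz' := inv_ne_zero hz
  rw [barrier, barrier, mul_inv_add hz, mul_inv_add hz, norm_mul, norm_mul,
      Real.log_mul (norm_ne_zero_iff.2 hz') (norm_ne_zero_iff.2 h₁),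
      Real.log_mul (norm_ne_zero_iff.2 hz') (norm_ne_zero_iff.2 h₂), add_sub_add_left_eq_sub, hn,
      norm_inv]
  have := norm_ne_zero_iff.2 hz
  field_simp

/-- The two unit discs `|z| ≤ 1` and `|1 / z| ≤ 1` cover the sphere, so a bound on both is a bound
on the whole annulus. -/
theorem barrier_le_of_forall_unit_disc {a b c d : ℂ} {n₁ n₂ : ℂ → ℝ} {ε : ℝ}
    (hn : ∀ z, z ≠ 0 → a * z + b ≠ 0 → c * z + d ≠ 0 → n₁ z = n₂ z⁻¹ / ‖z‖ ^ 2)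
    {M : ℝ} (h1 : ∀ z ∈ annulus a b c d ε ∩ Metric.closedBall 0 1, barrier a b c d n₁ ε z ≤ M)
    (h2 : ∀ z ∈ annulus b a d c ε ∩ Metric.closedBall 0 1, barrier b a d c n₂ ε z ≤ M)
    {z : ℂ} (hz : z ∈ annulus a b c d ε) : barrier a b c d n₁ ε z ≤ M := by
  rcases le_or_gt ‖z‖ 1 with hle | hlt
  · exact h1 z ⟨hz, by simpa using hle⟩
  · have hz0 : z ≠ 0 := norm_pos_iff.1 (one_pos.trans hlt)
    rw [← barrier_inv hz0 hz.1 hz.2.1 (hn z hz0 hz.1 hz.2.1)]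
    refine h2 _ ⟨mem_annulus_inv hz0 hz, ?_⟩
    simpa using inv_le_one_of_one_le₀ hlt.le

theorem _root_.IsCompact.exists_forall_le_or {X : Type*} [TopologicalSpace X] {s t : Set X}
    (hs : IsCompact s) (ht : IsCompact t) {f g : X → ℝ} (hf : ContinuousOn f s)
    (hg : ContinuousOn g t) (hne : (s ∪ t).Nonempty) :
    (∃ x ∈ s, (∀ y ∈ s, f y ≤ f x) ∧ ∀ y ∈ t, g y ≤ f x) ∨
      ∃ x ∈ t, (∀ y ∈ s, f y ≤ g x) ∧ ∀ y ∈ t, g y ≤ g x := by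
  rcases s.eq_empty_or_nonempty with rfl | hs'
  · obtain ⟨x, hx, hmax⟩ := ht.exists_isMaxOn (by simpa using hne) hg
    exact Or.inr ⟨x, hx, by simp, fun y hy => hmax hy⟩
  rcases t.eq_empty_or_nonempty with rfl | ht'
  · obtain ⟨x, hx, hmax⟩ := hs.exists_isMaxOn hs' hf
    exact Or.inl ⟨x, hx, fun y hy => hmax hy, by simp⟩
  obtain ⟨x, hx, hx'⟩ := hs.exists_isMaxOn hs' hf
  obtain ⟨y, hy, hy'⟩ := ht.exists_isMaxOn ht' hg
  rcases le_total (f x) (g y) with h | h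
  · exact Or.inr ⟨y, hy, fun w hw => (hx' hw).trans h, fun w hw => hy' hw⟩
  · exact Or.inl ⟨x, hx, fun w hw => hx' hw, fun w hw => (hy' hw).trans h⟩

theorem barrier_le {a b c d : ℂ} {n₁ n₂ : ℂ → ℝ} {ε : ℝ} (hdet : a * d - b * c ≠ 0) (hε : 0 < ε)
    (H₁ : ∀ z, a * z + b ≠ 0 → c * z + d ≠ 0 → IsSpecialNormAt n₁ z)
    (H₂ : ∀ z, b * z + a ≠ 0 → d * z + c ≠ 0 → IsSpecialNormAt n₂ z)
    (hn₁ : ∀ z, z ≠ 0 → a * z + b ≠ 0 → c * z + d ≠ 0 → n₁ z = n₂ z⁻¹ / ‖z‖ ^ 2)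
    (hn₂ : ∀ z, z ≠ 0 → b * z + a ≠ 0 → d * z + c ≠ 0 → n₂ z = n₁ z⁻¹ / ‖z‖ ^ 2)
    {z : ℂ} (hz : z ∈ annulus a b c d ε) : barrier a b c d n₁ ε z ≤ ε * ‖a * d - b * c‖ := by
  have hdet₂ : b * c - a * d ≠ 0 := fun h => hdet (by linear_combination -h)
  have hnorm : ‖b * c - a * d‖ = ‖a * d - b * c‖ := norm_sub_rev _ _
  have hne : (annulus a b c d ε ∩ Metric.closedBall 0 1 ∪
      annulus b a d c ε ∩ Metric.closedBall 0 1).Nonempty := by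
    rcases le_or_gt ‖z‖ 1 with hle | hlt
    · exact ⟨z, Or.inl ⟨hz, by simpa using hle⟩⟩
    · refine ⟨z⁻¹, Or.inr ⟨mem_annulus_inv (norm_pos_iff.1 (one_pos.trans hlt)) hz, ?_⟩⟩
      simpa using inv_le_one_of_one_le₀ hlt.le
  rcases (isCompact_annulus_inter hdet hε).exists_forall_le_or
    (isCompact_annulus_inter hdet₂ hε)
    ((continuousOn_barrier H₁).mono Set.inter_subset_left)
    ((continuousOn_barrier H₂).mono Set.inter_subset_left) hne with
    ⟨x, hx, h1, h2⟩ | ⟨x, hx, h1, h2⟩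
  · exact (barrier_le_of_forall_unit_disc hn₁ h1 h2 hz).trans
      (barrier_le_of_isMaxOn hdet hε (H₁ x hx.1.1 hx.1.2.1) hx.1
        fun y hy => barrier_le_of_forall_unit_disc hn₁ h1 h2 hy)
  · rw [← hnorm]
    exact (barrier_le_of_forall_unit_disc hn₁ h1 h2 hz).trans
      (barrier_le_of_isMaxOn hdet₂ hε (H₂ x hx.1.1 hx.1.2.1) hx.1
        fun y hy => barrier_le_of_forall_unit_disc hn₂ h2 h1 hy)

/-- A conformal density on the sphere minus the zeros of the forms `a z + b` and `c z + d`, given by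
`n₁` in the coordinate `z` and by `n₂` in the coordinate `1 / z`, vanishes if it comes locally from
special Kähler structures. -/
theorem eq_zero_of_isSpecialNormAt {a b c d : ℂ} {n₁ n₂ : ℂ → ℝ} (hdet : a * d - b * c ≠ 0)
    (H₁ : ∀ z, a * z + b ≠ 0 → c * z + d ≠ 0 → IsSpecialNormAt n₁ z)
    (H₂ : ∀ z, b * z + a ≠ 0 → d * z + c ≠ 0 → IsSpecialNormAt n₂ z)
    (hn₁ : ∀ z, z ≠ 0 → a * z + b ≠ 0 → c * z + d ≠ 0 → n₁ z = n₂ z⁻¹ / ‖z‖ ^ 2)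
    (hn₂ : ∀ z, z ≠ 0 → b * z + a ≠ 0 → d * z + c ≠ 0 → n₂ z = n₁ z⁻¹ / ‖z‖ ^ 2)
    {z : ℂ} (h₁ : a * z + b ≠ 0) (h₂ : c * z + d ≠ 0) : n₁ z = 0 := by
  set t := Real.log ‖a * z + b‖ - Real.log ‖c * z + d‖ with ht
  set P := n₁ z * (‖a * z + b‖ * ‖c * z + d‖) with hP
  have hl : Tendsto (fun ε : ℝ => P * Real.cos (ε * t)) (𝓝[>] 0) (𝓝 P) := by
    have : Continuous fun ε : ℝ => P * Real.cos (ε * t) := by fun_prop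
    simpa using (this.tendsto 0).mono_left nhdsWithin_le_nhds
  have hr : Tendsto (fun ε : ℝ => ε * ‖a * d - b * c‖) (𝓝[>] 0) (𝓝 0) := by
    have : Continuous fun ε : ℝ => ε * ‖a * d - b * c‖ := by fun_prop
    simpa using (this.tendsto 0).mono_left nhdsWithin_le_nhds
  have hsmall : ∀ᶠ ε : ℝ in 𝓝[>] 0, ε * |t| ≤ Real.pi / 2 := by
    have : Continuous fun ε : ℝ => ε * |t| := by fun_prop
    have h0 := (this.tendsto 0).mono_left (nhdsWithin_le_nhds (s := Set.Ioi 0))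
    rw [zero_mul] at h0
    exact h0.eventually (ge_mem_nhds (by positivity))
  have hle : P ≤ 0 := by
    refine le_of_tendsto_of_tendsto hl hr ?_
    filter_upwards [hsmall, self_mem_nhdsWithin] with ε hε hpos
    exact barrier_le hdet hpos H₁ H₂ hn₁ hn₂ ⟨h₁, h₂, hε⟩
  have hpos : 0 < ‖a * z + b‖ * ‖c * z + d‖ :=
    mul_pos (norm_pos_iff.2 h₁) (norm_pos_iff.2 h₂)
  exact le_antisymm (nonpos_of_mul_nonpos_left hle hpos) (H₁ z h₁ h₂).nonneg

end SpecialKahler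

namespace SpecialKahlerStructure

open ComplexConjugate

variable {M : Type*} [TopologicalSpace M] [ChartedSpace ℂ M] [IsManifold 𝓘(ℂ) ω M] {U : Set M}
  {e e' : OpenPartialHomeomorph M ℂ} {z : ℂ} {x : M}

/-! ### Continuation of the density over nonsingular points -/

theorem extendsTo_self (σ : SpecialKahlerStructure M U) : σ.ExtendsTo U :=
  ⟨σ, fun _ _ _ _ => ⟨rfl, rfl⟩⟩

theorem singularPoints_subset (σ : SpecialKahlerStructure M U) : σ.singularPoints ⊆ Uᶜ := by
  intro x hx hxU
  apply hx
  rw [Set.insert_eq_of_mem hxU]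
  exact σ.extendsTo_self

open Classical in
/-- The connection of some extension of `σ` over the point `x`; the connection of `σ` itself if
there is none. -/
noncomputable def extendedConnection (σ : SpecialKahlerStructure M U) (x : M)
    (e : OpenPartialHomeomorph M ℂ) : ℂ → ℂ →L[ℝ] ℂ →L[ℝ] ℂ :=
  if h : σ.ExtendsTo (insert x U) then h.choose.connection e else σ.connection e

theorem exists_extendedConnection (σ : SpecialKahlerStructure M U) (hx : x ∉ σ.singularPoints) :
    ∃ τ : SpecialKahlerStructure M (insert x U), σ.extendedConnection x = τ.connection := by
  have h : σ.ExtendsTo (insert x U) := not_not.1 hx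
  exact ⟨h.choose, funext fun e => by rw [extendedConnection, dif_pos h]⟩

theorem extendedConnection_eq (σ : SpecialKahlerStructure M U) (x : M) (he : e ∈ atlas ℂ M)
    (hz : z ∈ e.target ∩ e.symm ⁻¹' U) : σ.extendedConnection x e z = σ.connection e z := by
  rw [extendedConnection]
  split_ifs with h
  · exact (h.choose_spec e he z hz).2
  · rfl

/-- The length density `|(∇_∂ₓ I) ∂ₓ|` in the chart `e`, continued over the nonsingular points. At
each point the extension of `σ` over this very point is used; near a nonsingular point all choices
agree. -/
noncomputable def tensorNorm (σ : SpecialKahlerStructure M U) (e : OpenPartialHomeomorph M ℂ)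
    (z : ℂ) : ℝ :=
  ‖nablaI (σ.extendedConnection (e.symm z) e) z 1 1‖

theorem tensorNorm_eq (σ : SpecialKahlerStructure M U) (he : e ∈ atlas ℂ M)
    (hz : z ∈ e.target ∩ e.symm ⁻¹' U) : σ.tensorNorm e z = ‖nablaI (σ.connection e) z 1 1‖ := by
  simp only [tensorNorm, nablaI, σ.extendedConnection_eq _ he hz]

theorem isSpecialNormAt (σ : SpecialKahlerStructure M U) (he : e ∈ atlas ℂ M)
    (hz : z ∈ e.target) (hU : IsOpen (insert (e.symm z) U))
    (hs : e.symm z ∉ σ.singularPoints) : IsSpecialNormAt (σ.tensorNorm e) z := by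
  obtain ⟨τ, hτ⟩ := σ.exists_extendedConnection hs
  refine ⟨_, _, _, e.isOpen_inter_preimage_symm hU, ⟨hz, Set.mem_insert _ _⟩,
    τ.isSpecialKahlerOn e he, fun y hy => ?_⟩
  rw [← hτ]
  by_cases hyz : y = z
  · subst hyz
    rfl
  · have hyU : e.symm y ∈ U :=
      hy.2.resolve_left fun h => hyz (e.symm.injOn hy.1 hz h)
    rw [σ.tensorNorm_eq he ⟨hy.1, hyU⟩]
    simp only [nablaI, σ.extendedConnection_eq _ he ⟨hy.1, hyU⟩]

/-- The tensor `∇I` is conjugate bilinear, so in a change of coordinates with derivative `D` one has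
`D N = D̄² N'`, and the norms transform as a length density. -/
theorem tensorNorm_change (σ : SpecialKahlerStructure M U) (he : e ∈ atlas ℂ M)
    (he' : e' ∈ atlas ℂ M) (hz : z ∈ e.target) (hz' : e.symm z ∈ e'.source)
    (hs : e.symm z ∉ σ.singularPoints)
    (hd : deriv (e' ∘ e.symm) z ≠ 0) :
    σ.tensorNorm e z = σ.tensorNorm e' (e' (e.symm z)) * ‖deriv (e' ∘ e.symm) z‖ := by
  obtain ⟨τ, hτ⟩ := σ.exists_extendedConnection hs
  rw [tensorNorm, tensorNorm, e'.left_inv hz', hτ]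
  have hx : e' (e.symm z) ∈ e'.target ∩ e'.symm ⁻¹' (insert (e.symm z) U) :=
    ⟨e'.map_source hz', by rw [Set.mem_preimage, e'.left_inv hz']; exact Set.mem_insert _ _⟩
  have h := τ.connection_change e he e' he' z ⟨hz, Set.mem_insert _ _, hz'⟩ 1
  set D := deriv (e' ∘ e.symm) z
  have key : D * nablaI (τ.connection e) z 1 1
      = nablaI (τ.connection e') (e' (e.symm z)) 1 1 * conj D ^ 2 := by
    have h1 : D * nablaI (τ.connection e) z 1 1
        = nablaI (τ.connection e') (e' (e.symm z)) D D := by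
      simp only [nablaI, mul_sub]
      rw [mul_left_comm D, h, h]
      simp only [Function.comp, mul_one, mul_comm D Complex.I]
      ring
    rw [h1, (τ.isSpecialKahlerOn e' he').nablaI_eq hx, (τ.isSpecialKahlerOn e' he').nablaI_eq hx]
    simp
    ring
  have hk := congrArg (‖·‖) key
  simp only [norm_mul, norm_pow, RCLike.norm_conj] at hk
  have hD := norm_ne_zero_iff.2 hd
  apply mul_left_cancel₀ hD
  rw [hk]
  ring

theorem nablaI_ne_zero_of_cubicCoeff_ne_zero {σ : SpecialKahlerStructure M U}
    (h : σ.cubicCoeff e z ≠ 0) : nablaI (σ.connection e) z 1 1 ≠ 0 := by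
  intro h0
  simp [cubicCoeff, cubicForm, kahlerForm, h0] at h

end SpecialKahlerStructure

namespace P1

open OnePoint

/-! ### Linear forms on the sphere -/

/-- Each point of `ℙ¹` is the zero of a linear form, written in both standard coordinates. -/
theorem exists_linear_form (p : P1) : ∃ a b : ℂ, (∀ z : ℂ, a * z + b = 0 ↔ (z : P1) = p) ∧
    ∀ w : ℂ, b * w + a = 0 ↔ invCoe w = p := by
  induction p using OnePoint.rec with
  | infty =>
    refine ⟨0, 1, fun z => by simp, fun w => ?_⟩
    by_cases hw : w = 0
    · simp [hw, invCoe_zero]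
    · simp [hw, invCoe_of_ne hw]
  | coe p =>
    refine ⟨1, -p, fun z => by simp [← sub_eq_add_neg, sub_eq_zero], fun w => ?_⟩
    by_cases hw : w = 0
    · simp [hw, invCoe_zero]
    · rw [invCoe_of_ne hw, coe_eq_coe, inv_eq_iff_eq_inv, ← one_div]
      constructor
      · intro h
        have h1 : p * w = 1 := by linear_combination -h
        rw [eq_div_iff (left_ne_zero_of_mul_eq_one h1), mul_comm, h1]
      · rintro rfl
        have hp : p ≠ 0 := fun hp => hw (by simp [hp])
        field_simp
        ring

theorem det_ne_zero {p q : P1} (hpq : p ≠ q) {a b c d : ℂ}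
    (hp : ∀ z : ℂ, a * z + b = 0 ↔ (z : P1) = p) (hp' : ∀ w : ℂ, b * w + a = 0 ↔ invCoe w = p)
    (hq : ∀ z : ℂ, c * z + d = 0 ↔ (z : P1) = q) (hq' : ∀ w : ℂ, d * w + c = 0 ↔ invCoe w = q) :
    a * d - b * c ≠ 0 := by
  intro h
  induction p using OnePoint.rec with
  | infty =>
    have ha : a = 0 := by simpa [invCoe_zero] using hp' 0
    have hb : b ≠ 0 := by simpa using (hp 0).not
    have hc : c = 0 := by simpa [ha, hb] using h
    exact hpq (by simpa [hc, invCoe_zero] using hq' 0)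
  | coe p =>
    have ha : a ≠ 0 := by simpa [invCoe_zero] using (hp' 0).not
    have h1 := (hp p).2 rfl
    have h2 : a * (c * p + d) = 0 := by linear_combination c * h1 + h
    exact hpq ((hq p).1 ((mul_eq_zero.1 h2).resolve_left ha))

theorem inftyChart_comp_affineChart_symm : inftyChart ∘ affineChart.symm = Inv.inv := rfl

theorem affineChart_comp_inftyChart_symm : affineChart ∘ inftyChart.symm = Inv.inv := by
  ext1 w
  by_cases hw : w = 0
  · subst hw
    simp only [Function.comp, inftyChart_symm_apply, invCoe_zero, inv_zero]
    rfl
  · simp [inftyChart_symm_apply, invCoe_of_ne hw, affineChart_coe]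

theorem mem_atlas_iff {e : OpenPartialHomeomorph P1 ℂ} :
    e ∈ atlas ℂ P1 ↔ e = affineChart ∨ e = inftyChart := Iff.rfl

end P1

namespace SpecialKahlerStructure

open P1

/-! ### At most two singular points -/

theorem tensorNorm_affineChart {U : Set P1} (σ : SpecialKahlerStructure P1 U) {z : ℂ} (hz : z ≠ 0)
    (hs : (z : P1) ∉ σ.singularPoints) :
    σ.tensorNorm affineChart z = σ.tensorNorm inftyChart z⁻¹ / ‖z‖ ^ 2 := by
  have hd : ‖deriv (inftyChart ∘ affineChart.symm) z‖ = (‖z‖ ^ 2)⁻¹ := by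
    rw [inftyChart_comp_affineChart_symm, deriv_inv]
    simp
  have h := σ.tensorNorm_change (e := affineChart) (e' := inftyChart) (z := z)
    (Or.inl rfl) (Or.inr rfl)
    (Set.mem_univ z) (by simpa [affineChart_symm_apply, inftyChart_source] using hz) hs
    (norm_ne_zero_iff.1 (by rw [hd]; simpa using hz))
  rw [h, hd]
  rfl

theorem tensorNorm_inftyChart {U : Set P1} (σ : SpecialKahlerStructure P1 U) {w : ℂ} (hw : w ≠ 0)
    (hs : invCoe w ∉ σ.singularPoints) :
    σ.tensorNorm inftyChart w = σ.tensorNorm affineChart w⁻¹ / ‖w‖ ^ 2 := by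
  have hd : ‖deriv (affineChart ∘ inftyChart.symm) w‖ = (‖w‖ ^ 2)⁻¹ := by
    rw [affineChart_comp_inftyChart_symm, deriv_inv]
    simp
  have h := σ.tensorNorm_change (e := inftyChart) (e' := affineChart) (z := w)
    (Or.inr rfl) (Or.inl rfl)
    (Set.mem_univ w) (by simp [inftyChart_symm_apply, affineChart_source, invCoe_of_ne hw]) hs
    (norm_ne_zero_iff.1 (by rw [hd]; simpa using hw))
  rw [h, hd, ← Function.comp_apply (f := affineChart), affineChart_comp_inftyChart_symm]
  rfl

theorem tensorNorm_eq_zero {S : Set P1} (hS : S.Finite) (σ : SpecialKahlerStructure P1 Sᶜ)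
    {p q : P1} (hpq : p ≠ q) (hσ : σ.singularPoints ⊆ {p, q}) {e : OpenPartialHomeomorph P1 ℂ}
    (he : e ∈ atlas ℂ P1) {z : ℂ} (hz : e.symm z ∉ ({p, q} : Set P1)) : σ.tensorNorm e z = 0 := by
  obtain ⟨a, b, hp, hp'⟩ := exists_linear_form p
  obtain ⟨c, d, hq, hq'⟩ := exists_linear_form q
  have hdet := det_ne_zero hpq hp hp' hq hq'
  have hdet' : b * c - a * d ≠ 0 := fun h => hdet (by linear_combination -h)
  have hopen : ∀ x, IsOpen (insert x Sᶜ) := fun x => by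
    rw [← isClosed_compl_iff]
    refine (hS.subset fun y hy => ?_).isClosed
    by_contra hyS
    exact hy (Or.inr hyS)
  have h₁ : ∀ z, a * z + b ≠ 0 → c * z + d ≠ 0 → (z : P1) ∉ σ.singularPoints :=
    fun z h h' hs => (hσ hs).elim (fun h₀ => h ((hp z).2 h₀)) fun h₀ => h' ((hq z).2 h₀)
  have h₂ : ∀ w, b * w + a ≠ 0 → d * w + c ≠ 0 → invCoe w ∉ σ.singularPoints :=
    fun w h h' hs => (hσ hs).elim (fun h₀ => h ((hp' w).2 h₀)) fun h₀ => h' ((hq' w).2 h₀)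
  have H₁ : ∀ z, a * z + b ≠ 0 → c * z + d ≠ 0 → IsSpecialNormAt (σ.tensorNorm affineChart) z :=
    fun z h h' => σ.isSpecialNormAt (Or.inl rfl) (Set.mem_univ z) (hopen _) (h₁ z h h')
  have H₂ : ∀ w, b * w + a ≠ 0 → d * w + c ≠ 0 → IsSpecialNormAt (σ.tensorNorm inftyChart) w :=
    fun w h h' => σ.isSpecialNormAt (Or.inr rfl) (Set.mem_univ w) (hopen _) (h₂ w h h')
  have hn₁ := fun z (hz : z ≠ 0) h h' => σ.tensorNorm_affineChart hz (h₁ z h h')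
  have hn₂ := fun w (hw : w ≠ 0) h h' => σ.tensorNorm_inftyChart hw (h₂ w h h')
  rw [Set.mem_insert_iff, Set.mem_singleton_iff, not_or] at hz
  rcases mem_atlas_iff.1 he with rfl | rfl
  · exact eq_zero_of_isSpecialNormAt hdet H₁ H₂ hn₁ hn₂ ((hp z).not.2 hz.1) ((hq z).not.2 hz.2)
  · exact eq_zero_of_isSpecialNormAt hdet' H₂ H₁ hn₂ hn₁ ((hp' z).not.2 hz.1) ((hq' z).not.2 hz.2)

end SpecialKahlerStructure

theorem mainTheorem6 (S : Set P1) (hS : S.Finite) (σ : SpecialKahlerStructure P1 Sᶜ)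
    (hΞ : σ.CubicFormMeromorphic) (hΞ' : σ.CubicFormNontrivial) :
    3 ≤ σ.singularPoints.encard := by
  by_contra! hlt
  have hle : σ.singularPoints.encard ≤ 2 := Order.le_of_lt_add_one (hlt.trans_eq (by norm_num))
  obtain ⟨e, he, z, hz, hne⟩ := hΞ'
  have hsub : σ.singularPoints ⊆ {e.symm z}ᶜ := fun x hx hxz =>
    σ.singularPoints_subset hx (by rw [Set.mem_singleton_iff.1 hxz]; exact hz.2)
  have hinf : ({e.symm z}ᶜ : Set P1).Infinite := (Set.finite_singleton _).infinite_compl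
  -- Two points containing all singular points but not the point where the cubic form is nonzero.
  obtain ⟨r, hr, hr', hcard⟩ :=
    Set.exists_superset_subset_encard_eq hsub hle (by rw [hinf.encard_eq]; exact le_top)
  obtain ⟨p, q, hpq, rfl⟩ := Set.encard_eq_two.1 hcard
  have h0 := σ.tensorNorm_eq_zero hS hpq hr he (z := z) fun h => hr' h rfl
  rw [σ.tensorNorm_eq he hz, norm_eq_zero] at h0
  exact SpecialKahlerStructure.nablaI_ne_zero_of_cubicCoeff_ne_zero hne h0
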